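/- A perfect binary tree is a finite rooted tree in which every non-leaf node has exactly two children and all leaves have the same distance from the root. (The one-node tree is a perfect binary tree.) A finite set $P\subset\mathbb{R}^2$ is in general orthogonal position if no two of its points share the same $x$-coordinate or the same $y$-coordinate. A planar L-shaped drawing of a graph $G$ on $P$ places the vertices of $G$ at distinct points of $P$ (points of $P$ may remain unused) and draws every edge as an orthogonal path consisting of one horizontal and one vertical segment between its endpoints, such that no edge passes through a vertex other than its own endpoints and any two distinct edges intersect at most in a common endpoint. Theorem. There is an absolute constant $c>0$ such that for every $n\ge 1$, every perfect binary tree with $n$ nodes has a planar L-shaped drawing on every finite point set $P\subset\mathbb{R}^2$ in general orthogonal position with $|P|\ge c\, n^{1.142}$. -/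

import Mathlib

namespace LShaped

/-! ### Perfect binary trees -/

section Trees

/-- In the tree `G` rooted at `r`, the vertex `w` is a child of `v`. -/
def IsChild {V : Type*} (G : SimpleGraph V) (r v w : V) : Prop :=
  G.Adj v w ∧ G.dist r w = G.dist r v + 1

/-- In the tree `G` rooted at `r`, the vertex `v` is a leaf: it has no child. -/
def IsLeaf {V : Type*} (G : SimpleGraph V) (r v : V) : Prop :=
  ∀ w, ¬ IsChild G r v w

/-- `G` with root `r` is a perfect binary tree: it is a tree, every non-leaf node has exactly two
children, and all leaves are at the same distance from the root. -/
structure IsPerfectBinaryTree {V : Type*} (G : SimpleGraph V) (r : V) : Prop where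
  isTree : G.IsTree
  two_children : ∀ v, ¬ IsLeaf G r v → {w | IsChild G r v w}.ncard = 2
  leaves_same_height : ∀ u v, IsLeaf G r u → IsLeaf G r v → G.dist r u = G.dist r v

end Trees

/-! ### Planar L-shaped drawings -/

section Drawings

/-- No two points share the same `x`-coordinate or the same `y`-coordinate. -/
def GeneralOrthogonalPosition (P : Finset (ℝ × ℝ)) : Prop :=
  Set.InjOn Prod.fst (P : Set (ℝ × ℝ)) ∧ Set.InjOn Prod.snd (P : Set (ℝ × ℝ))

/-- `b` is one of the two possible bends of an orthogonal path with two segments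
between `p` and `q`. -/
def IsLBend (p q b : ℝ × ℝ) : Prop :=
  b = (p.1, q.2) ∨ b = (q.1, p.2)

/-- The orthogonal path that represents the edge `e`, where `pos` gives the positions of the
vertices and `bend` the bends of the edges: for `e = s(u, v)` it is the union of the two segments
from `pos u` to the bend and from the bend to `pos v`. -/
def route {V : Type*} (pos : V → ℝ × ℝ) (bend : Sym2 V → ℝ × ℝ) (e : Sym2 V) : Set (ℝ × ℝ) :=
  ⋃ v ∈ e, segment ℝ (pos v) (bend e)

/-- A planar L-shaped drawing of the graph `G` on the point set `P`: distinct vertices are placed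
at distinct points of `P` (points of `P` may stay unused), every edge is an orthogonal path of two
segments between its endpoints, no edge passes through a vertex that is not one of its endpoints,
and two distinct edges meet at most in a common endpoint. -/
structure PlanarLDrawing {V : Type*} (G : SimpleGraph V) (P : Finset (ℝ × ℝ)) where
  pos : V → ℝ × ℝ
  bend : Sym2 V → ℝ × ℝ
  pos_mem : ∀ v, pos v ∈ P
  pos_injective : Function.Injective pos
  isLBend : ∀ u v, G.Adj u v → IsLBend (pos u) (pos v) (bend s(u, v))
  vertex_notMem_route : ∀ e ∈ G.edgeSet, ∀ v, v ∉ e → pos v ∉ route pos bend e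
  route_inter_route : ∀ e ∈ G.edgeSet, ∀ f ∈ G.edgeSet, e ≠ f →
    ∀ z ∈ route pos bend e ∩ route pos bend f, ∃ v, v ∈ e ∧ v ∈ f ∧ z = pos v

end Drawings

end LShaped

namespace LShaped

/-! ### Addressing the nodes of a perfect binary tree by binary words. -/

section Addresses

variable {V : Type*} {G : SimpleGraph V} {r : V}

/-! The core is a recursion for a number `f m` of points that suffices for height `m`. A
root-to-leaf path (the spine) of the tree of height `m + 1` is placed on `m + 2` monotone points.
The subtrees hanging off it have heights `m, m - 1, ..., 0`. They are drawn inductively in disjoint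
strips of lower points, and since `f` at least doubles they need at most `2 * f m` points together.

After a reflection the spine descends. Points at its lower left are cut into rows, points at its
lower right into columns; only points within its horizontal range are lost. A spine vertex reaches a
subtree in a row from the right and one in a column from above. So the induction carries a free
upward ray at the root, and exchanging the coordinates gives a free rightward ray
(`exists_treeDrawing_of_isDescending`).

To lose little, take the `40 * ((m + 1) ^ 2 + 1)` highest points. Split by `x` into 40 blocks of
equal size, they contain a block with at most 1/40 of the remaining points in its range
(`exists_few_between`). Inside it, Erdős–Szekeres gives `m + 2` monotone points. Hence `(39 / 40) *
(f (m + 1) - 40 * ((m + 1) ^ 2 + 1)) ≥ 2 * f m` is enough (`upUniversal`). As `80 / 39 < 2.1`, `f m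
= ⌈4000 * 2.1 ^ m⌉` works. Finally `2.1 ≤ 2 ^ 1.1`, and a tree of height `m` has at least `2 ^ m`
nodes. -/

theorem eq_of_adj_of_dist_eq (hG : G.IsTree) {u w v : V} (hu : G.Adj u v) (hw : G.Adj w v)
    (du : G.dist r v = G.dist r u + 1) (dw : G.dist r v = G.dist r w + 1) : u = w := by
  obtain ⟨p, hp⟩ := hG.connected.exists_walk_length_eq_dist r u
  obtain ⟨q, hq⟩ := hG.connected.exists_walk_length_eq_dist r w
  have hp' : (p.concat hu).IsPath := by
    apply SimpleGraph.Walk.isPath_of_length_eq_dist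
    simp [hp, du]
  have hq' : (q.concat hw).IsPath := by
    apply SimpleGraph.Walk.isPath_of_length_eq_dist
    simp [hq, dw]
  have := (hG.existsUnique_path r v).unique hp' hq'
  simpa using congrArg SimpleGraph.Walk.penultimate this

theorem exists_parent (hG : G.IsTree) {v : V} (hv : v ≠ r) :
    ∃ u, G.Adj u v ∧ G.dist r v = G.dist r u + 1 := by
  obtain ⟨p, hp⟩ := hG.connected.exists_walk_length_eq_dist r v
  have hnil : ¬ p.Nil := fun h => hv h.eq.symm
  refine ⟨p.penultimate, p.adj_penultimate hnil, ?_⟩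
  have h1 : G.dist r p.penultimate ≤ p.dropLast.length := SimpleGraph.dist_le _
  have h2 := p.adj_penultimate hnil
  have h3 := hG.dist_eq_dist_add_one_of_adj r h2
  have h4 : p.dropLast.length + 1 = p.length := by
    have := p.length_dropLast_add_one hnil
    omega
  omega

/-- The vertices of a perfect binary tree of height `m` are injectively labelled by binary words of
length at most `m`, such that deleting the first letter is passing to the parent. -/
theorem IsPerfectBinaryTree.exists_address [Fintype V] (h : IsPerfectBinaryTree G r) :
    ∃ (m : ℕ) (addr : V → List Bool), 2 ^ m ≤ Fintype.card V ∧ Function.Injective addr ∧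
      (∀ v, (addr v).length ≤ m) ∧
      ∀ u v, G.Adj u v → (∃ b, addr v = b :: addr u) ∨ (∃ b, addr u = b :: addr v) := by
  classical
  have hG := h.isTree
  choose! par hadj hdist using fun v => exists_parent (r := r) hG (v := v)
  have hpar : ∀ u v, G.Adj u v → G.dist r v = G.dist r u + 1 → v ≠ r ∧ par v = u := by
    intro u v huv hd
    have hv : v ≠ r := by rintro rfl; simp at hd
    exact ⟨hv, eq_of_adj_of_dist_eq hG (hadj v hv) huv (hdist v hv) hd⟩
  have hlab : ∀ v, ∃ f : V → Bool, Set.InjOn f {w | IsChild G r v w} := by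
    intro v
    by_cases hv : IsLeaf G r v
    · exact ⟨fun _ => true, fun w hw => (hv w hw).elim⟩
    · obtain ⟨a, b, hab, he⟩ := Set.ncard_eq_two.1 (h.two_children v hv)
      refine ⟨fun w => decide (w = a), ?_⟩
      rw [he]
      rintro x (rfl | rfl) y (rfl | rfl) hxy <;> simp_all
  choose lab hlab using hlab
  -- Reads `n` labels while climbing from the vertex. Recursing on `n`, with the depth substituted
  -- later, makes the recursion structural.
  let ra : ℕ → V → List Bool := fun n =>
    Nat.rec (fun _ => []) (fun _ f v => lab (par v) v :: f (par v)) n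
  have ra0 : ∀ v, ra 0 v = [] := fun _ => rfl
  have ras : ∀ n v, ra (n + 1) v = lab (par v) v :: ra n (par v) := fun _ _ => rfl
  have hlen : ∀ n v, (ra n v).length = n := by
    intro n
    induction n with
    | zero => intro v; simp [ra0]
    | succ n ih => intro v; simp [ras, ih]
  let addr : V → List Bool := fun v => ra (G.dist r v) v
  have haddr : ∀ v, v ≠ r → addr v = lab (par v) v :: addr (par v) := by
    intro v hv
    simp only [addr]
    rw [hdist v hv, ras]
  have hinj : ∀ n u v, G.dist r u = n → G.dist r v = n → ra n u = ra n v → u = v := by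
    intro n
    induction n with
    | zero =>
      intro u v hu hv _
      rw [hG.connected.dist_eq_zero_iff] at hu hv
      rw [← hu, ← hv]
    | succ n ih =>
      intro u v hu hv he
      have hur : u ≠ r := by rintro rfl; simp at hu
      have hvr : v ≠ r := by rintro rfl; simp at hv
      have du := hdist u hur
      have dv := hdist v hvr
      rw [ras, ras] at he
      obtain ⟨h1, h2⟩ := List.cons.inj he
      have hp := ih _ _ (by omega) (by omega) h2
      rw [← hp] at h1
      exact hlab (par u) ⟨hadj u hur, du⟩ ⟨hp ▸ hadj v hvr, hp ▸ dv⟩ h1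
  obtain ⟨x, -, hx⟩ := Finset.exists_max_image Finset.univ (fun v => G.dist r v) ⟨r, by simp⟩
  have hxleaf : IsLeaf G r x := by
    intro w hw
    have := hx w (by simp)
    have := hw.2
    omega
  have hnl : ∀ v, G.dist r v < G.dist r x → ¬ IsLeaf G r v := by
    intro v hv hl
    have := h.leaves_same_height v x hl hxleaf
    omega
  -- Level sizes at least double down to the deepest level: by the equal depth of leaves no earlier
  -- vertex is a leaf, and distinct vertices have disjoint sets of children.
  have hlevel : ∀ i ≤ G.dist r x,
      2 ^ i ≤ (Finset.univ.filter (fun v => G.dist r v = i)).card := by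
    intro i
    induction i with
    | zero =>
      intro _
      simp only [pow_zero]
      exact Finset.card_pos.2 ⟨r, by simp⟩
    | succ i ih =>
      intro hi
      have hsub : (Finset.univ.filter (fun v => G.dist r v = i)).biUnion
          (fun v => Finset.univ.filter (fun w => IsChild G r v w)) ⊆
          Finset.univ.filter (fun v => G.dist r v = i + 1) := by
        intro w hw
        simp only [Finset.mem_biUnion, Finset.mem_filter, Finset.mem_univ, true_and] at hw ⊢
        obtain ⟨v, hv, hw⟩ := hw
        rw [hw.2, hv]
      refine le_trans ?_ (Finset.card_le_card hsub)
      rw [Finset.card_biUnion]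
      · have hc : ∀ v ∈ Finset.univ.filter (fun v => G.dist r v = i),
            (Finset.univ.filter (fun w => IsChild G r v w)).card = 2 := by
          intro v hv
          simp only [Finset.mem_filter, Finset.mem_univ, true_and] at hv
          rw [← h.two_children v (hnl v (by omega)), Set.ncard_eq_toFinset_card']
          congr 1
          ext w
          simp
        rw [Finset.sum_congr rfl hc, Finset.sum_const, smul_eq_mul, pow_succ]
        exact Nat.mul_le_mul_right 2 (ih (by omega))
      · intro u _ v _ huv
        rw [Function.onFun, Finset.disjoint_left]
        intro w hu hv
        simp only [Finset.mem_filter, Finset.mem_univ, true_and] at hu hv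
        exact huv (eq_of_adj_of_dist_eq hG hu.1 hv.1 hu.2 hv.2)
  refine ⟨G.dist r x, addr, (hlevel _ le_rfl).trans (Finset.card_filter_le _ _), ?_, ?_, ?_⟩
  · intro u v huv
    have hl : G.dist r u = G.dist r v := by
      have := congrArg List.length huv
      simpa [addr, hlen] using this
    refine hinj _ u v rfl hl.symm ?_
    simpa only [addr, hl] using huv
  · intro v
    simp only [addr, hlen]
    exact hx v (by simp)
  · intro u v huv
    rcases hG.dist_eq_dist_add_one_of_adj r huv with hd | hd
    · obtain ⟨hne, rfl⟩ := hpar v u huv.symm hd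
      exact Or.inr ⟨_, haddr u hne⟩
    · obtain ⟨hne, rfl⟩ := hpar u v huv hd
      exact Or.inl ⟨_, haddr v hne⟩

end Addresses

/-! ### Recursive drawings and their translation into planar L-shaped drawings. -/

section TreeDrawings

/-- The orthogonal path from `p` to `q` with bend `b`. -/
def leg (p b q : ℝ × ℝ) : Set (ℝ × ℝ) := segment ℝ p b ∪ segment ℝ q b

/-- `TreeDrawing S m p I`: the perfect binary tree of height `m` has a planar L-shaped drawing with
all vertices in `S`, the root at `p`, and `I` the union of all vertices and edges. -/
inductive TreeDrawing (S : Set (ℝ × ℝ)) : ℕ → ℝ × ℝ → Set (ℝ × ℝ) → Prop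
  | leaf (p : ℝ × ℝ) (hp : p ∈ S) : TreeDrawing S 0 p {p}
  | node (m : ℕ) (p : ℝ × ℝ) (r b : Bool → ℝ × ℝ) (I : Bool → Set (ℝ × ℝ)) (hp : p ∈ S)
      (hsub : ∀ c, TreeDrawing S m (r c) (I c)) (hb : ∀ c, IsLBend p (r c) (b c))
      (hne : ∀ c, p ≠ r c) (hII : ∀ c d, c ≠ d → Disjoint (I c) (I d))
      (hLI : ∀ c, leg p (b c) (r c) ∩ I c ⊆ {r c})
      (hLI' : ∀ c d, c ≠ d → Disjoint (leg p (b c) (r c)) (I d))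
      (hLL : ∀ c d, c ≠ d → leg p (b c) (r c) ∩ leg p (b d) (r d) ⊆ {p}) :
      TreeDrawing S (m + 1) p (⋃ c, I c ∪ leg p (b c) (r c))

theorem TreeDrawing.root_mem_ink {S I : Set (ℝ × ℝ)} {m : ℕ} {p : ℝ × ℝ}
    (h : TreeDrawing S m p I) : p ∈ I := by
  cases h with
  | leaf _ hp => rfl
  | node m p r b I => exact Set.mem_iUnion.2 ⟨true, Or.inr (Or.inl (left_mem_segment ℝ _ _))⟩

theorem TreeDrawing.root_mem {S I : Set (ℝ × ℝ)} {m : ℕ} {p : ℝ × ℝ}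
    (h : TreeDrawing S m p I) : p ∈ S := by
  cases h <;> assumption

theorem TreeDrawing.mono {S S' I : Set (ℝ × ℝ)} {m : ℕ} {p : ℝ × ℝ}
    (h : TreeDrawing S m p I) (hS : S ⊆ S') : TreeDrawing S' m p I := by
  induction h with
  | leaf p hp => exact .leaf p (hS hp)
  | node m p r b I hp _ hb hne hII hLI hLI' hLL ih =>
    exact .node m p r b I (hS hp) ih hb hne hII hLI hLI' hLL

theorem leg_image (f : (ℝ × ℝ) →ᵃ[ℝ] (ℝ × ℝ)) (p b q : ℝ × ℝ) :
    leg (f p) (f b) (f q) = f '' leg p b q := by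
  simp [leg, Set.image_union, image_segment]

theorem TreeDrawing.map {S I : Set (ℝ × ℝ)} {m : ℕ} {p : ℝ × ℝ}
    (f : (ℝ × ℝ) →ᵃ[ℝ] (ℝ × ℝ)) (hf : Function.Injective f)
    (hfb : ∀ p q b, IsLBend p q b → IsLBend (f p) (f q) (f b))
    (h : TreeDrawing S m p I) : TreeDrawing (f '' S) m (f p) (f '' I) := by
  induction h with
  | leaf p hp =>
    rw [Set.image_singleton]
    exact .leaf _ (Set.mem_image_of_mem _ hp)
  | node m p r b I hp _ hb hne hII hLI hLI' hLL ih =>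
    have := TreeDrawing.node (S := f '' S) m (f p) (fun c => f (r c)) (fun c => f (b c))
      (fun c => f '' I c) (Set.mem_image_of_mem _ hp) ih (fun c => hfb _ _ _ (hb c))
      (fun c => hf.ne (hne c))
      (fun c d hcd => (Set.disjoint_image_iff hf).2 (hII c d hcd))
      (fun c => by
        rw [leg_image, ← Set.image_inter hf, ← Set.image_singleton]
        exact Set.image_mono (hLI c))
      (fun c d hcd => by
        rw [leg_image]
        exact (Set.disjoint_image_iff hf).2 (hLI' c d hcd))
      (fun c d hcd => by
        rw [leg_image, leg_image, ← Set.image_inter hf, ← Set.image_singleton]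
        exact Set.image_mono (hLL c d hcd))
    simpa only [leg_image, Set.image_iUnion, Set.image_union] using this

/-- The edge above the vertex with address `l`. -/
def addressEdge (pos bend : List Bool → ℝ × ℝ) (l : List Bool) : Set (ℝ × ℝ) :=
  leg (pos l.dropLast) (bend l) (pos l)

/-- A planar L-shaped drawing of the perfect binary tree of height `m` whose vertices are the binary
words of length at most `m`. -/
structure IsAddressDrawing (S I : Set (ℝ × ℝ)) (m : ℕ) (pos bend : List Bool → ℝ × ℝ) : Prop where
  pos_mem : ∀ l, l.length ≤ m → pos l ∈ S
  pos_ink : ∀ l, l.length ≤ m → pos l ∈ I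
  inj : ∀ l l', l.length ≤ m → l'.length ≤ m → pos l = pos l' → l = l'
  isLBend : ∀ l, l ≠ [] → l.length ≤ m → IsLBend (pos l.dropLast) (pos l) (bend l)
  edge_ink : ∀ l, l ≠ [] → l.length ≤ m → addressEdge pos bend l ⊆ I
  vertex : ∀ l l', l ≠ [] → l.length ≤ m → l'.length ≤ m → pos l' ∈ addressEdge pos bend l →
    l' = l ∨ l' = l.dropLast
  inter : ∀ l l', l ≠ [] → l' ≠ [] → l.length ≤ m → l'.length ≤ m → l ≠ l' →
    ∀ z ∈ addressEdge pos bend l ∩ addressEdge pos bend l',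
      ∃ w, (w = l ∨ w = l.dropLast) ∧ (w = l' ∨ w = l'.dropLast) ∧ z = pos w

/-- The local conditions at each node imply global planarity: everything in a subtree lies in its
ink, so edges of different subtrees are disjoint, and a root edge meets a subtree at most in that
child. -/
theorem TreeDrawing.exists_isAddressDrawing {S I : Set (ℝ × ℝ)} {m : ℕ} {p : ℝ × ℝ}
    (h : TreeDrawing S m p I) :
    ∃ pos bend : List Bool → ℝ × ℝ, pos [] = p ∧ IsAddressDrawing S I m pos bend := by
  induction h with
  | leaf p hp =>
    refine ⟨fun _ => p, fun _ => p, rfl, ⟨?_, ?_, ?_, ?_, ?_, ?_, ?_⟩⟩ <;> simp_all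
  | node m p r b I hp _ hb hne hII hLI hLI' hLL ih =>
    choose pos bend hr hD using ih
    let pos' : List Bool → ℝ × ℝ := fun l => List.casesOn l p (fun c t => pos c t)
    let bend' : List Bool → ℝ × ℝ := fun l => List.casesOn l p
      (fun c t => List.casesOn t (b c) (fun d s => bend c (d :: s)))
    have e1 : ∀ c, addressEdge pos' bend' [c] = leg p (b c) (r c) := by
      intro c
      simp [addressEdge, pos', bend', hr]
    have e2 : ∀ c d t, addressEdge pos' bend' (c :: d :: t) =
        addressEdge (pos c) (bend c) (d :: t) := by
      intro c d t
      simp [addressEdge, pos', bend']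
    have hpL : ∀ c, p ∈ leg p (b c) (r c) := fun c => Or.inl (left_mem_segment ℝ _ _)
    have hpI : ∀ c, p ∉ I c := fun c hc => hne c (hLI c ⟨hpL c, hc⟩)
    have dIL : ∀ c d, c ≠ d → ∀ z ∈ I c, z ∉ leg p (b d) (r d) := fun c d hcd z hz hz' =>
      (hLI' d c hcd.symm).le_bot ⟨hz', hz⟩
    refine ⟨pos', bend', rfl, ⟨?_, ?_, ?_, ?_, ?_, ?_, ?_⟩⟩
    · rintro (_ | ⟨c, t⟩) hl
      · exact hp
      · exact (hD c).pos_mem t (by simpa using hl)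
    · rintro (_ | ⟨c, t⟩) hl
      · exact Set.mem_iUnion.2 ⟨true, Or.inr (hpL true)⟩
      · exact Set.mem_iUnion.2 ⟨c, Or.inl ((hD c).pos_ink t (by simpa using hl))⟩
    · rintro (_ | ⟨c, t⟩) (_ | ⟨d, s⟩) hl hl' he
      · rfl
      · exact (hpI d ((show p = pos d s from he) ▸ (hD d).pos_ink s (by simpa using hl'))).elim
      · exact (hpI c ((show pos c t = p from he) ▸ (hD c).pos_ink t (by simpa using hl))).elim
      · have h1 := (hD c).pos_ink t (by simpa using hl)
        have h2 := (hD d).pos_ink s (by simpa using hl')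
        have he : pos c t = pos d s := he
        by_cases hcd : c = d
        · subst hcd
          rw [(hD c).inj t s (by simpa using hl) (by simpa using hl') he]
        · exact ((hII c d hcd).le_bot ⟨h1, he ▸ h2⟩).elim
    · rintro (_ | ⟨c, _ | ⟨d, t⟩⟩) hl hm
      · exact (hl rfl).elim
      · simpa [pos', bend', hr] using hb c
      · have := (hD c).isLBend (d :: t) (by simp) (by simpa using hm)
        simpa [pos', bend'] using this
    · rintro (_ | ⟨c, _ | ⟨d, t⟩⟩) hl hm
      · exact (hl rfl).elim
      · rw [e1]
        exact fun z hz => Set.mem_iUnion.2 ⟨c, Or.inr hz⟩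
      · rw [e2]
        exact fun z hz => Set.mem_iUnion.2
          ⟨c, Or.inl ((hD c).edge_ink _ (by simp) (by simpa using hm) hz)⟩
    · rintro (_ | ⟨c, _ | ⟨d, t⟩⟩) l' hl hm hm' hz
      · exact (hl rfl).elim
      · rw [e1] at hz
        rcases l' with _ | ⟨c', s⟩
        · simp
        · have h2 := (hD c').pos_ink s (by simpa using hm')
          by_cases hcd : c' = c
          · subst hcd
            have h3 : pos c' s = r c' := hLI c' ⟨hz, h2⟩
            have := (hD c').inj s [] (by simpa using hm') (by simp) (by rw [h3, hr])
            simp [this]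
          · exact (dIL c' c hcd _ h2 hz).elim
      · rw [e2] at hz
        have h1 := (hD c).edge_ink _ (by simp) (by simpa using hm) hz
        rcases l' with _ | ⟨c', s⟩
        · exact (hpI c h1).elim
        · have h2 := (hD c').pos_ink s (by simpa using hm')
          by_cases hcd : c' = c
          · subst hcd
            have := (hD c').vertex _ s (by simp) (by simpa using hm) (by simpa using hm') hz
            simpa using this
          · exact ((hII c' c hcd).le_bot ⟨h2, h1⟩).elim
    -- The mixed case: a root edge and an edge inside a subtree can meet only at the child `[d]`,
    -- and then the inner edge starts there.
    · have key : ∀ c d c' t, (c' :: t).length ≤ m → ∀ z ∈ leg p (b c) (r c),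
          z ∈ addressEdge (pos d) (bend d) (c' :: t) → c = d ∧ t = [] ∧ z = pos d [] := by
        intro c d c' t hm z hz hz'
        have h1 := (hD d).edge_ink _ (by simp) hm hz'
        by_cases hcd : d = c
        · subst hcd
          have h3 : z = pos d [] := (hLI d ⟨hz, h1⟩).trans (hr d).symm
          rw [h3] at hz'
          have := (hD d).vertex _ [] (by simp) hm (by simp) hz'
          refine ⟨rfl, ?_, h3⟩
          rcases this with h | h
          · simp at h
          · cases t with
            | nil => rfl
            | cons _ _ => simp at h
        · exact (dIL d c hcd _ h1 hz).elim
      rintro (_ | ⟨c, _ | ⟨d, t⟩⟩) (_ | ⟨c', _ | ⟨d', t'⟩⟩) hl hl' hm hm' hll z ⟨hz, hz'⟩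
      · exact (hl rfl).elim
      · exact (hl rfl).elim
      · exact (hl rfl).elim
      · exact (hl' rfl).elim
      · rw [e1] at hz hz'
        have hcc : c ≠ c' := fun h => hll (by rw [h])
        exact ⟨[], by simp, by simp, hLL c c' hcc ⟨hz, hz'⟩⟩
      · rw [e1] at hz
        rw [e2] at hz'
        obtain ⟨rfl, rfl, h3⟩ := key c c' d' t' (by simpa using hm') z hz hz'
        exact ⟨[c], by simp, by simp, h3⟩
      · exact (hl' rfl).elim
      · rw [e1] at hz'
        rw [e2] at hz
        obtain ⟨rfl, rfl, h3⟩ := key c' c d t (by simpa using hm) z hz' hz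
        exact ⟨[c'], by simp, by simp, h3⟩
      · rw [e2] at hz hz'
        by_cases hcd : c = c'
        · subst hcd
          obtain ⟨w, h1, h2, h3⟩ := (hD c).inter (d :: t) (d' :: t') (by simp) (by simp)
            (by simpa using hm) (by simpa using hm') (fun h => hll (by rw [h])) z ⟨hz, hz'⟩
          exact ⟨c :: w, by simpa using h1, by simpa using h2, h3⟩
        · exact ((hII c c' hcd).le_bot ⟨(hD c).edge_ink _ (by simp) (by simpa using hm) hz,
            (hD c').edge_ink _ (by simp) (by simpa using hm') hz'⟩).elim

/-- A drawing of the perfect binary tree of height `m` gives a drawing of every graph that embeds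
into it. -/
theorem IsAddressDrawing.nonempty_planarLDrawing {V : Type*} [Nonempty V] {G : SimpleGraph V}
    {P : Finset (ℝ × ℝ)} {I : Set (ℝ × ℝ)} {m : ℕ} {pos bend : List Bool → ℝ × ℝ}
    (h : IsAddressDrawing (P : Set (ℝ × ℝ)) I m pos bend) (addr : V → List Bool)
    (hinj : Function.Injective addr) (hlen : ∀ v, (addr v).length ≤ m)
    (hadj : ∀ u v, G.Adj u v → (∃ b, addr v = addr u ++ [b]) ∨ (∃ b, addr u = addr v ++ [b])) :
    Nonempty (PlanarLDrawing G P) := by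
  classical
  have hedge : ∀ e ∈ G.edgeSet, ∃ u v b, e = s(u, v) ∧ addr v = addr u ++ [b] := by
    intro e
    induction e with
    | h u v =>
      intro he
      rcases hadj u v he with ⟨b, hb⟩ | ⟨b, hb⟩
      · exact ⟨u, v, b, rfl, hb⟩
      · exact ⟨v, u, b, Sym2.eq_swap, hb⟩
  choose! up low lt he hal using hedge
  have hlow : ∀ e ∈ G.edgeSet, addr (low e) ≠ [] := fun e h => by simp [hal e h]
  have hup : ∀ e ∈ G.edgeSet, (addr (low e)).dropLast = addr (up e) := fun e h => by
    simp [hal e h]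
  have hmem : ∀ e ∈ G.edgeSet, ∀ v, v ∈ e ↔ v = up e ∨ v = low e := by
    intro e h v
    conv_lhs => rw [he e h]
    simp
  let P' : V → ℝ × ℝ := fun v => pos (addr v)
  let B : Sym2 V → ℝ × ℝ := fun e => bend (addr (low e))
  have hroute : ∀ e ∈ G.edgeSet, route P' B e = addressEdge pos bend (addr (low e)) := by
    intro e h
    ext z
    simp only [route, Set.mem_iUnion, hmem e h, addressEdge, leg, hup e h, exists_prop,
      Set.mem_union, P', B]
    constructor
    · rintro ⟨v, rfl | rfl, hz⟩
      · exact Or.inl hz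
      · exact Or.inr hz
    · rintro (hz | hz)
      · exact ⟨_, Or.inl rfl, hz⟩
      · exact ⟨_, Or.inr rfl, hz⟩
  refine ⟨⟨P', B, fun v => h.pos_mem _ (hlen v), fun u v huv => hinj
    (h.inj _ _ (hlen u) (hlen v) huv), ?_, ?_, ?_⟩⟩
  · intro u v huv
    have hm : s(u, v) ∈ G.edgeSet := huv
    have h1 := h.isLBend _ (hlow _ hm) (hlen _)
    rw [hup _ hm] at h1
    have h2 := he _ hm
    rcases Sym2.eq_iff.1 h2 with ⟨h3, h4⟩ | ⟨h3, h4⟩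
    · rw [← h3, ← h4] at h1
      simpa only [P', B, ← h4] using h1
    · rw [← h3, ← h4] at h1
      simp only [P', B, ← h3]
      exact h1.symm
  · intro e hm v hv hz
    rw [hroute e hm] at hz
    apply hv
    rw [hmem e hm]
    rcases h.vertex _ _ (hlow e hm) (hlen _) (hlen v) hz with h1 | h1
    · exact Or.inr (hinj h1)
    · rw [hup e hm] at h1
      exact Or.inl (hinj h1)
  · intro e hm f hm' hef z hz
    rw [hroute e hm, hroute f hm'] at hz
    have hne : addr (low e) ≠ addr (low f) := by
      intro h1
      apply hef
      have h2 := hup e hm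
      rw [h1, hup f hm'] at h2
      rw [he e hm, he f hm', hinj h1, hinj h2]
    obtain ⟨w, h1, h2, h3⟩ := h.inter _ _ (hlow e hm) (hlow f hm') (hlen _) (hlen _) hne z hz
    rw [hup e hm] at h1
    rw [hup f hm'] at h2
    obtain ⟨v, rfl, hv⟩ : ∃ v, w = addr v ∧ (v = up e ∨ v = low e) := by
      rcases h1 with h1 | h1
      · exact ⟨_, h1, Or.inr rfl⟩
      · exact ⟨_, h1, Or.inl rfl⟩
    refine ⟨v, (hmem e hm v).2 hv, (hmem f hm' v).2 ?_, h3⟩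
    rcases h2 with h2 | h2
    · exact Or.inr (hinj h2)
    · exact Or.inl (hinj h2)

/-- Addresses are reversed because `exists_address` puts the step nearest the vertex first, whereas
drawings put it last. -/
theorem IsPerfectBinaryTree.exists_height {V : Type*} [Fintype V] {G : SimpleGraph V} {r : V}
    (h : IsPerfectBinaryTree G r) : ∃ m : ℕ, 2 ^ m ≤ Fintype.card V ∧
      ∀ (P : Finset (ℝ × ℝ)) (p : ℝ × ℝ) (I : Set (ℝ × ℝ)),
        TreeDrawing (P : Set (ℝ × ℝ)) m p I → Nonempty (PlanarLDrawing G P) := by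
  have : Nonempty V := ⟨r⟩
  obtain ⟨m, addr, hcard, hinj, hlen, hadj⟩ := h.exists_address
  refine ⟨m, hcard, fun P p I hD => ?_⟩
  obtain ⟨pos, bend, -, hA⟩ := hD.exists_isAddressDrawing
  refine hA.nonempty_planarLDrawing (fun v => (addr v).reverse)
    (fun u v huv => hinj (List.reverse_injective huv)) (fun v => by simpa using hlen v) ?_
  intro u v huv
  rcases hadj u v huv with ⟨b, hb⟩ | ⟨b, hb⟩
  · exact Or.inl ⟨b, by simp [hb]⟩
  · exact Or.inr ⟨b, by simp [hb]⟩

end TreeDrawings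

/-! ### Selecting extreme, monotone and sparsely overlapped point sets. -/

section Selection

/-- The `n` elements of largest key. -/
theorem exists_top_subset {α : Type*} [DecidableEq α] (A : Finset α) (key : α → ℝ)
    (hkey : Set.InjOn key (A : Set α)) (n : ℕ) (hn : n + 1 ≤ A.card) :
    ∃ A₁ ⊆ A, A₁.card = n + 1 ∧ ∃ a₀ ∈ A₁, (∀ a ∈ A₁, key a₀ ≤ key a) ∧
      ∀ a ∈ A \ A₁, key a < key a₀ := by
  induction n with
  | zero =>
    obtain ⟨a, ha, hmax⟩ := A.exists_max_image key (Finset.card_pos.1 hn)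
    refine ⟨{a}, by simpa using ha, by simp, a, by simp, by simp, fun b hb => ?_⟩
    rw [Finset.mem_sdiff, Finset.mem_singleton] at hb
    exact lt_of_le_of_ne (hmax b hb.1) (fun h => hb.2 (hkey hb.1 ha h))
  | succ n ih =>
    obtain ⟨A₁, hsub, hcard, a₀, -, hle, hlt⟩ := ih (by omega)
    have hne : (A \ A₁).Nonempty := by
      rw [← Finset.card_pos, Finset.card_sdiff_of_subset hsub]
      omega
    obtain ⟨a, ha, hmax⟩ := (A \ A₁).exists_max_image key hne
    have haA := (Finset.mem_sdiff.1 ha).1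
    refine ⟨insert a A₁, Finset.insert_subset haA hsub, ?_, a, by simp, ?_, ?_⟩
    · rw [Finset.card_insert_of_notMem (Finset.mem_sdiff.1 ha).2, hcard]
    · intro b hb
      rcases Finset.mem_insert.1 hb with rfl | hb
      · exact le_rfl
      · exact (hlt a ha).le.trans (hle b hb)
    · intro b hb
      simp only [Finset.mem_sdiff, Finset.mem_insert, not_or] at hb
      exact lt_of_le_of_ne (hmax b (Finset.mem_sdiff.2 ⟨hb.1, hb.2.2⟩))
        (fun h => hb.2.1 (hkey hb.1 haA h))

/-- A weak form of the Erdős–Szekeres theorem for points in the plane. -/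
theorem exists_chain_or_antichain (a b : ℕ) (W : Finset (ℝ × ℝ)) (hW : a * b < W.card) :
    (∃ T ⊆ W, T.card = a + 1 ∧ ∀ p ∈ T, ∀ q ∈ T, p ≠ q →
      (p.1 < q.1 ∧ p.2 < q.2) ∨ (q.1 < p.1 ∧ q.2 < p.2)) ∨
    (∃ T ⊆ W, T.card = b + 1 ∧ ∀ p ∈ T, ∀ q ∈ T, ¬ (p.1 < q.1 ∧ p.2 < q.2)) := by
  classical
  induction a generalizing W with
  | zero =>
    left
    obtain ⟨p, hp⟩ := Finset.card_pos.1 (lt_of_le_of_lt (Nat.zero_le _) hW)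
    refine ⟨{p}, by simpa using hp, by simp, ?_⟩
    intro x hx y hy hxy
    rw [Finset.mem_singleton] at hx hy
    exact (hxy (hx.trans hy.symm)).elim
  | succ a ih =>
    -- The minimal points form an antichain. If there are at most `b` of them, deleting them leaves
    -- more than `a * b` points.
    set M := W.filter (fun p => ∀ q ∈ W, ¬ (q.1 < p.1 ∧ q.2 < p.2)) with hM
    have hMW : M ⊆ W := Finset.filter_subset _ _
    by_cases hMc : b + 1 ≤ M.card
    · right
      obtain ⟨T, hT, hc⟩ := Finset.exists_subset_card_eq hMc
      refine ⟨T, hT.trans hMW, hc, fun p hp q hq => ?_⟩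
      exact (Finset.mem_filter.1 (hT hq)).2 p (hMW (hT hp))
    · have hc : a * b < (W \ M).card := by
        rw [Finset.card_sdiff_of_subset hMW]
        have : (a + 1) * b = a * b + b := by ring
        omega
      rcases ih (W \ M) hc with ⟨T, hT, hTc, hch⟩ | ⟨T, hT, hTc, hch⟩
      · left
        -- The leftmost point of a chain is its least. Having survived the deletion it is not
        -- minimal in `W`, so the chain extends downward.
        obtain ⟨t, ht, hmin⟩ := T.exists_min_image Prod.fst (Finset.card_pos.1 (by omega))
        have htW := Finset.mem_sdiff.1 (hT ht)
        obtain ⟨q, hq, hqt⟩ : ∃ q ∈ W, q.1 < t.1 ∧ q.2 < t.2 := by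
          by_contra! hno
          exact htW.2 (Finset.mem_filter.2 ⟨htW.1, fun q hq h => (hno q hq h.1).not_gt h.2⟩)
        have hqs : ∀ s ∈ T, q.1 < s.1 ∧ q.2 < s.2 := by
          intro s hs
          by_cases hst : t = s
          · exact hst ▸ hqt
          · rcases hch t ht s hs hst with h | h
            · exact ⟨hqt.1.trans h.1, hqt.2.trans h.2⟩
            · exact ((hmin s hs).not_gt h.1).elim
        have hqT : q ∉ T := fun h => lt_irrefl _ (hqs q h).1
        refine ⟨insert q T, Finset.insert_subset hq (hT.trans Finset.sdiff_subset), ?_, ?_⟩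
        · rw [Finset.card_insert_of_notMem hqT, hTc]
        · intro x hx y hy hxy
          rcases Finset.mem_insert.1 hx with hx | hx <;>
            rcases Finset.mem_insert.1 hy with hy | hy
          · exact (hxy (hx.trans hy.symm)).elim
          · exact Or.inl (hx ▸ hqs y hy)
          · exact Or.inr (hy ▸ hqs x hx)
          · exact hch x hx y hy hxy
      · exact Or.inr ⟨T, hT.trans Finset.sdiff_subset, hTc, hch⟩

/-- The points of `D` whose `x`-coordinate is in the range of the `x`-coordinates of `W`. -/
noncomputable def between (D W : Finset (ℝ × ℝ)) : Finset (ℝ × ℝ) :=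
  D.filter (fun d => (∃ w ∈ W, w.1 ≤ d.1) ∧ ∃ w ∈ W, d.1 ≤ w.1)

/-- Among `(g + 1) * (w + 1)` points there are `w + 1` such that at most the `(g + 1)`-st part of
`D` is between them. -/
theorem exists_few_between (g w : ℕ) (U D : Finset (ℝ × ℝ))
    (hU : Set.InjOn Prod.fst (U : Set (ℝ × ℝ))) (hc : (g + 1) * (w + 1) ≤ U.card) :
    ∃ W ⊆ U, W.card = w + 1 ∧ (g + 1) * (between D W).card ≤ D.card := by
  classical
  induction g generalizing U D with
  | zero =>
    obtain ⟨W, hW, hWc⟩ := Finset.exists_subset_card_eq (s := U) (n := w + 1) (by omega)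
    refine ⟨W, hW, hWc, ?_⟩
    rw [zero_add, one_mul]
    exact Finset.card_le_card (Finset.filter_subset _ D)
  | succ g ih =>
    have hring : (g + 1 + 1) * (w + 1) = (g + 1) * (w + 1) + (w + 1) := by ring
    -- Test the rightmost block. If too much of `D` lies at or to the right of its left end `a₀`,
    -- discard the block together with that part of `D`; more than a `1 / (g + 2)` fraction goes, so
    -- the bound for the rest improves accordingly.
    obtain ⟨W₁, hsub, hcard, a₀, ha₀, hle, hlt⟩ :=
      exists_top_subset U Prod.fst hU w (by omega)
    have hsum := Finset.card_filter_add_card_filter_not (s := D) (fun d => a₀.1 ≤ d.1)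
    by_cases h1 : (g + 1 + 1) * (D.filter (fun d => a₀.1 ≤ d.1)).card ≤ D.card
    · refine ⟨W₁, hsub, hcard, le_trans (Nat.mul_le_mul_left _ (Finset.card_le_card ?_)) h1⟩
      intro d hd
      obtain ⟨hd, ⟨x, hx, hxd⟩, -⟩ := Finset.mem_filter.1 hd
      exact Finset.mem_filter.2 ⟨hd, (hle x hx).trans hxd⟩
    · obtain ⟨W, hW, hWc, hb⟩ := ih (U \ W₁) (D.filter (fun d => ¬ a₀.1 ≤ d.1))
        (hU.mono (by exact_mod_cast Finset.sdiff_subset))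
        (by rw [Finset.card_sdiff_of_subset hsub]; omega)
      refine ⟨W, hW.trans Finset.sdiff_subset, hWc, ?_⟩
      have hsubset : between D W ⊆ between (D.filter (fun d => ¬ a₀.1 ≤ d.1)) W := by
        intro d hd
        obtain ⟨hd, hx, y, hy, hdy⟩ := Finset.mem_filter.1 hd
        refine Finset.mem_filter.2 ⟨Finset.mem_filter.2 ⟨hd, ?_⟩, hx, y, hy, hdy⟩
        exact not_le.2 (lt_of_le_of_lt hdy (hlt y (hW hy)))
      have hle' := Finset.card_le_card hsubset
      by_contra hcon
      rw [not_le] at h1 hcon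
      have e1 := Nat.mul_le_mul_left (g + 1 + 1) ((Nat.mul_le_mul_left (g + 1) hle').trans hb)
      have e2 := Nat.mul_le_mul_left (g + 1) hcon
      nlinarith

end Selection

/-! ### Geometry of L-shaped paths and the spine construction. -/

section Staircases

theorem mem_leg_of_vertical {p q z : ℝ × ℝ} (h : z ∈ leg p (p.1, q.2) q) :
    (z.1 = p.1 ∧ z.2 ∈ Set.uIcc p.2 q.2) ∨ (z.2 = q.2 ∧ z.1 ∈ Set.uIcc p.1 q.1) := by
  rcases h with h | h
  · left
    have h1 := (Prod.segment_subset _ _ h).1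
    have h2 := (Prod.segment_subset _ _ h).2
    rw [segment_eq_uIcc] at h2
    exact ⟨by simpa using h1, h2⟩
  · right
    have h1 := (Prod.segment_subset _ _ h).1
    have h2 := (Prod.segment_subset _ _ h).2
    rw [segment_eq_uIcc] at h1
    exact ⟨by simpa using h2, Set.uIcc_comm q.1 p.1 ▸ h1⟩

theorem mem_leg_of_horizontal {p q z : ℝ × ℝ} (h : z ∈ leg p (q.1, p.2) q) :
    (z.2 = p.2 ∧ z.1 ∈ Set.uIcc p.1 q.1) ∨ (z.1 = q.1 ∧ z.2 ∈ Set.uIcc p.2 q.2) := by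
  have h' : z ∈ leg q (q.1, p.2) p := Or.symm h
  rcases mem_leg_of_vertical h' with ⟨h1, h2⟩ | ⟨h1, h2⟩
  · exact Or.inr ⟨h1, Set.uIcc_comm q.2 p.2 ▸ h2⟩
  · exact Or.inl ⟨h1, Set.uIcc_comm q.1 p.1 ▸ h2⟩

/-- The bounding box of a set of points. -/
def boundingBox (S : Set (ℝ × ℝ)) : Set (ℝ × ℝ) :=
  {z | (∃ s ∈ S, s.1 ≤ z.1) ∧ (∃ s ∈ S, z.1 ≤ s.1) ∧ (∃ s ∈ S, s.2 ≤ z.2) ∧ ∃ s ∈ S, z.2 ≤ s.2}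

theorem subset_boundingBox (S : Set (ℝ × ℝ)) : S ⊆ boundingBox S :=
  fun z hz => ⟨⟨z, hz, le_rfl⟩, ⟨z, hz, le_rfl⟩, ⟨z, hz, le_rfl⟩, ⟨z, hz, le_rfl⟩⟩

theorem mem_boundingBox_of_mem_uIcc {S : Set (ℝ × ℝ)} {p q z : ℝ × ℝ} (hp : p ∈ S) (hq : q ∈ S)
    (h1 : z.1 ∈ Set.uIcc p.1 q.1) (h2 : z.2 ∈ Set.uIcc p.2 q.2) : z ∈ boundingBox S := by
  rw [Set.mem_uIcc] at h1 h2
  refine ⟨?_, ?_, ?_, ?_⟩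
  · rcases h1 with h | h
    exacts [⟨p, hp, h.1⟩, ⟨q, hq, h.1⟩]
  · rcases h1 with h | h
    exacts [⟨q, hq, h.2⟩, ⟨p, hp, h.2⟩]
  · rcases h2 with h | h
    exacts [⟨p, hp, h.1⟩, ⟨q, hq, h.1⟩]
  · rcases h2 with h | h
    exacts [⟨q, hq, h.2⟩, ⟨p, hp, h.2⟩]

theorem leg_subset_boundingBox {S : Set (ℝ × ℝ)} {p q b : ℝ × ℝ} (hp : p ∈ S) (hq : q ∈ S)
    (hb : IsLBend p q b) : leg p b q ⊆ boundingBox S := by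
  intro z hz
  rcases hb with rfl | rfl
  · rcases mem_leg_of_vertical hz with ⟨h1, h2⟩ | ⟨h1, h2⟩
    · exact mem_boundingBox_of_mem_uIcc hp hq (h1 ▸ Set.left_mem_uIcc) h2
    · exact mem_boundingBox_of_mem_uIcc hp hq h2 (h1 ▸ Set.right_mem_uIcc)
  · rcases mem_leg_of_horizontal hz with ⟨h1, h2⟩ | ⟨h1, h2⟩
    · exact mem_boundingBox_of_mem_uIcc hp hq h2 (h1 ▸ Set.left_mem_uIcc)
    · exact mem_boundingBox_of_mem_uIcc hp hq (h1 ▸ Set.right_mem_uIcc) h2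

theorem TreeDrawing.ink_subset_boundingBox {S I : Set (ℝ × ℝ)} {m : ℕ} {p : ℝ × ℝ}
    (h : TreeDrawing S m p I) : I ⊆ boundingBox S := by
  induction h with
  | leaf p hp => exact Set.singleton_subset_iff.2 (subset_boundingBox S hp)
  | node m p r b I hp hsub hb _ _ _ _ _ ih =>
    exact Set.iUnion_subset fun c =>
      Set.union_subset (ih c) (leg_subset_boundingBox hp (hsub c).root_mem (hb c))

theorem TreeDrawing.join {S J I : Set (ℝ × ℝ)} {m : ℕ} {p q r b b' : ℝ × ℝ} (hp : p ∈ S)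
    (hJ : TreeDrawing S m q J) (hI : TreeDrawing S m r I)
    (hb : IsLBend p q b) (hb' : IsLBend p r b') (hq : p ≠ q) (hr : p ≠ r)
    (hJI : ∀ z ∈ J, z ∉ I) (hlJ : ∀ z ∈ leg p b q, z ∈ J → z = q)
    (hlI : ∀ z ∈ leg p b q, z ∉ I) (hlI' : ∀ z ∈ leg p b' r, z ∈ I → z = r)
    (hlJ' : ∀ z ∈ leg p b' r, z ∉ J)
    (hll : ∀ z ∈ leg p b q, z ∈ leg p b' r → z = p) :
    TreeDrawing S (m + 1) p ((J ∪ leg p b q) ∪ (I ∪ leg p b' r)) := by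
  have := TreeDrawing.node (S := S) m p (fun c => cond c q r) (fun c => cond c b b')
    (fun c => cond c J I) hp (by rintro (_ | _) <;> assumption)
    (by rintro (_ | _) <;> assumption) (by rintro (_ | _) <;> assumption)
    (by
      rintro (_ | _) (_ | _) h
      · exact (h rfl).elim
      · exact (Set.disjoint_left.2 hJI).symm
      · exact Set.disjoint_left.2 hJI
      · exact (h rfl).elim)
    (by
      rintro (_ | _) z ⟨h1, h2⟩
      · exact hlI' z h1 h2
      · exact hlJ z h1 h2)
    (by
      rintro (_ | _) (_ | _) h
      · exact (h rfl).elim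
      · exact Set.disjoint_left.2 hlJ'
      · exact Set.disjoint_left.2 hlI
      · exact (h rfl).elim)
    (by
      rintro (_ | _) (_ | _) h z ⟨h1, h2⟩
      · exact (h rfl).elim
      · exact hll z h2 h1
      · exact hll z h1 h2
      · exact (h rfl).elim)
  rw [Set.union_eq_iUnion]
  convert this using 3 with c
  cases c <;> rfl

/-- The perfect binary tree of height `m` has a drawing on `S` in which the upward ray from the root
is free. -/
def UpDrawable (m : ℕ) (S : Set (ℝ × ℝ)) : Prop :=
  ∃ p I, TreeDrawing S m p I ∧ ∀ z ∈ I, z.1 = p.1 → z.2 ≤ p.2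

/-- The perfect binary tree of height `m` has a drawing on `S` in which the rightward ray from the
root is free. -/
def RightDrawable (m : ℕ) (S : Set (ℝ × ℝ)) : Prop :=
  ∃ p I, TreeDrawing S m p I ∧ ∀ z ∈ I, z.2 = p.2 → z.1 ≤ p.1

/-- Every set of `n` points in general orthogonal position admits an up-drawing of the perfect
binary tree of height `m`. -/
def UpUniversal (m n : ℕ) : Prop :=
  ∀ S : Finset (ℝ × ℝ), GeneralOrthogonalPosition S → n ≤ S.card → UpDrawable m (S : Set (ℝ × ℝ))

/-- Exchanging the coordinates preserves general position and L-shapes and turns upward rays into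
rightward rays. -/
theorem UpUniversal.rightDrawable {m n : ℕ} (h : UpUniversal m n) (S : Finset (ℝ × ℝ))
    (hS : GeneralOrthogonalPosition S) (hn : n ≤ S.card) :
    RightDrawable m (S : Set (ℝ × ℝ)) := by
  classical
  have hinj : Function.Injective (Prod.swap : ℝ × ℝ → ℝ × ℝ) := Prod.swap_injective
  have hG : GeneralOrthogonalPosition (S.image Prod.swap) := by
    constructor
    · intro x hx y hy hxy
      simp only [Finset.coe_image, Set.mem_image, Finset.mem_coe] at hx hy
      obtain ⟨x, hx, rfl⟩ := hx
      obtain ⟨y, hy, rfl⟩ := hy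
      rw [hS.2 hx hy hxy]
    · intro x hx y hy hxy
      simp only [Finset.coe_image, Set.mem_image, Finset.mem_coe] at hx hy
      obtain ⟨x, hx, rfl⟩ := hx
      obtain ⟨y, hy, rfl⟩ := hy
      rw [hS.1 hx hy hxy]
  obtain ⟨p, I, hD, hray⟩ := h _ hG (by rwa [Finset.card_image_of_injective _ hinj])
  have hD' := hD.map (LinearEquiv.prodComm ℝ ℝ ℝ).toLinearMap.toAffineMap hinj (by
    rintro p q b (rfl | rfl)
    · exact Or.inr rfl
    · exact Or.inl rfl)
  refine ⟨p.swap, _, hD'.mono ?_, ?_⟩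
  · rintro _ ⟨y, hy, rfl⟩
    simp only [Finset.coe_image, Set.mem_image, Finset.mem_coe] at hy
    obtain ⟨x, hx, rfl⟩ := hy
    exact hx
  · rintro _ ⟨y, hy, rfl⟩ h1
    exact hray y hy h1

/-- The reflection in the `y`-axis. -/
def reflect : (ℝ × ℝ) →ₗ[ℝ] (ℝ × ℝ) := LinearMap.prodMap (-LinearMap.id) LinearMap.id

@[simp] theorem reflect_apply (p : ℝ × ℝ) : reflect p = (-p.1, p.2) := rfl

theorem reflect_injective : Function.Injective reflect := by
  rintro ⟨a, b⟩ ⟨c, d⟩ h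
  simpa using h

theorem UpDrawable.reflect {m : ℕ} {S : Set (ℝ × ℝ)} (h : UpDrawable m S) :
    UpDrawable m (reflect '' S) := by
  obtain ⟨p, I, hD, hray⟩ := h
  refine ⟨_, _, hD.map LShaped.reflect.toAffineMap reflect_injective ?_, ?_⟩
  · rintro p q b (rfl | rfl)
    · exact Or.inl rfl
    · exact Or.inr rfl
  · rintro _ ⟨y, hy, rfl⟩ h1
    exact hray y hy (by simpa using h1)

/-- From left to right, the points of `T` go down. -/
def IsDescending (T : Finset (ℝ × ℝ)) : Prop :=
  ∀ p ∈ T, ∀ q ∈ T, p ≠ q → (p.1 < q.1 ∧ q.2 < p.2) ∨ (q.1 < p.1 ∧ p.2 < q.2)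

theorem GeneralOrthogonalPosition.subset {S T : Finset (ℝ × ℝ)} (h : GeneralOrthogonalPosition S)
    (hT : T ⊆ S) : GeneralOrthogonalPosition T :=
  ⟨h.1.mono (by exact_mod_cast hT), h.2.mono (by exact_mod_cast hT)⟩

/-- Joining a subtree in a row at the lower left of the root `p` with a subtree whose root is at the
lower right of `p`. -/
theorem TreeDrawing.join_row {S J I : Set (ℝ × ℝ)} {m : ℕ} {p q r : ℝ × ℝ} {θ : ℝ} (hp : p ∈ S)
    (hJ : TreeDrawing S m q J) (hI : TreeDrawing S m r I)
    (hJ1 : ∀ z ∈ J, z.1 < p.1 ∧ θ ≤ z.2 ∧ z.2 < p.2)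
    (hJ2 : ∀ z ∈ J, z.2 = q.2 → z.1 ≤ q.1)
    (hI1 : ∀ z ∈ I, z.2 ≤ r.2 ∧ (z.1 < r.1 → z.2 < θ)) (hpr : p.1 < r.1) (hrp : r.2 < p.2) :
    TreeDrawing S (m + 1) p ((J ∪ leg p (p.1, q.2) q) ∪ (I ∪ leg p (r.1, p.2) r)) := by
  obtain ⟨q1, q2, q3⟩ := hJ1 q hJ.root_mem_ink
  have hq : ∀ z ∈ leg p (p.1, q.2) q,
      (z.1 = p.1 ∧ q.2 ≤ z.2 ∧ z.2 ≤ p.2) ∨ (z.2 = q.2 ∧ q.1 ≤ z.1 ∧ z.1 ≤ p.1) := by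
    intro z hz
    have := mem_leg_of_vertical hz
    rwa [Set.uIcc_of_ge q3.le, Set.uIcc_of_ge q1.le] at this
  have hr : ∀ z ∈ leg p (r.1, p.2) r,
      (z.2 = p.2 ∧ p.1 ≤ z.1 ∧ z.1 ≤ r.1) ∨ (z.1 = r.1 ∧ r.2 ≤ z.2 ∧ z.2 ≤ p.2) := by
    intro z hz
    have := mem_leg_of_horizontal hz
    rwa [Set.uIcc_of_le hpr.le, Set.uIcc_of_ge hrp.le] at this
  refine .join hp hJ hI (Or.inl rfl) (Or.inr rfl) (fun h => ?_) (fun h => ?_) ?_ ?_ ?_ ?_ ?_ ?_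
  · rw [h] at q1; exact lt_irrefl _ q1
  · rw [h] at hpr; exact lt_irrefl _ hpr
  · intro z hz hz'
    have h1 := hJ1 z hz
    have h2 := (hI1 z hz').2 (by linarith)
    linarith
  · intro z hz hz'
    have h1 := hJ1 z hz'
    rcases hq z hz with h | h
    · linarith
    · exact Prod.ext (le_antisymm (hJ2 z hz' h.1) h.2.1) h.1
  · intro z hz hz'
    have h2 := (hI1 z hz').2
    rcases hq z hz with h | h
    · have := h2 (by linarith)
      linarith
    · have := h2 (by linarith)
      linarith
  · intro z hz hz'
    have h2 := hI1 z hz'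
    rcases hr z hz with h | h
    · linarith
    · exact Prod.ext h.1 (le_antisymm h2.1 h.2.1)
  · intro z hz hz'
    have h1 := hJ1 z hz'
    rcases hr z hz with h | h <;> linarith
  · intro z hz hz'
    rcases hq z hz with h | h <;> rcases hr z hz' with h' | h'
    · exact Prod.ext h.1 h'.1
    · linarith
    · linarith
    · linarith

/-- Joining a subtree in a column at the lower right of the root `p` with a subtree whose root is
between `p` and that column. -/
theorem TreeDrawing.join_column {S J I : Set (ℝ × ℝ)} {m : ℕ} {p q r : ℝ × ℝ} {θ ρ : ℝ}
    (hp : p ∈ S) (hJ : TreeDrawing S m q J) (hI : TreeDrawing S m r I)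
    (hJ1 : ∀ z ∈ J, θ ≤ z.1 ∧ z.2 < p.2) (hJ2 : ∀ z ∈ J, z.1 = q.1 → z.2 ≤ q.2)
    (hI1 : ∀ z ∈ I, z.2 ≤ r.2 ∧ z.1 < θ ∧ (z.1 < r.1 → z.2 < ρ)) (hρ : ρ ≤ r.2)
    (hpr : p.1 < r.1) (hrp : r.2 < p.2) :
    TreeDrawing S (m + 1) p ((J ∪ leg p (q.1, p.2) q) ∪ (I ∪ leg p (p.1, r.2) r)) := by
  obtain ⟨q1, q2⟩ := hJ1 q hJ.root_mem_ink
  have r1 := (hI1 r hI.root_mem_ink).2.1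
  have hpq : p.1 < q.1 := by linarith
  have hq : ∀ z ∈ leg p (q.1, p.2) q,
      (z.2 = p.2 ∧ p.1 ≤ z.1 ∧ z.1 ≤ q.1) ∨ (z.1 = q.1 ∧ q.2 ≤ z.2 ∧ z.2 ≤ p.2) := by
    intro z hz
    have := mem_leg_of_horizontal hz
    rwa [Set.uIcc_of_le hpq.le, Set.uIcc_of_ge q2.le] at this
  have hr : ∀ z ∈ leg p (p.1, r.2) r,
      (z.1 = p.1 ∧ r.2 ≤ z.2 ∧ z.2 ≤ p.2) ∨ (z.2 = r.2 ∧ p.1 ≤ z.1 ∧ z.1 ≤ r.1) := by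
    intro z hz
    have := mem_leg_of_vertical hz
    rwa [Set.uIcc_of_le hpr.le, Set.uIcc_of_ge hrp.le] at this
  refine .join hp hJ hI (Or.inr rfl) (Or.inl rfl) (fun h => ?_) (fun h => ?_) ?_ ?_ ?_ ?_ ?_ ?_
  · rw [h] at hpq; exact lt_irrefl _ hpq
  · rw [h] at hpr; exact lt_irrefl _ hpr
  · intro z hz hz'
    have h1 := hJ1 z hz
    have h2 := (hI1 z hz').2
    linarith
  · intro z hz hz'
    have h1 := hJ1 z hz'
    rcases hq z hz with h | h
    · linarith
    · exact Prod.ext h.1 (le_antisymm (hJ2 z hz' h.1) h.2.1)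
  · intro z hz hz'
    have h2 := hI1 z hz'
    rcases hq z hz with h | h <;> linarith
  · intro z hz hz'
    have h2 := (hI1 z hz').2.2
    rcases hr z hz with h | h
    · have := h2 (by linarith)
      linarith
    · rcases h.2.2.lt_or_eq with h3 | h3
      · have := h2 h3
        linarith
      · exact Prod.ext h3 h.1
  · intro z hz hz'
    have h1 := hJ1 z hz'
    rcases hr z hz with h | h <;> linarith
  · intro z hz hz'
    rcases hq z hz with h | h <;> rcases hr z hz' with h' | h'
    · exact Prod.ext h'.1 h.1
    · linarith
    · linarith
    · linarith

/-- A spine along the descending points `T`, from which the subtrees hang into rows of points of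
`A`, at the lower left of `T`, and into columns of points of `B`, at the lower right of `T`. -/
theorem exists_treeDrawing_of_isDescending {f : ℕ → ℕ} (hf : ∀ m, 1 ≤ f m)
    (hf2 : ∀ m, 2 * f m ≤ f (m + 1)) (m : ℕ) (hup : ∀ k < m, UpUniversal k (f k))
    (T A B : Finset (ℝ × ℝ)) (hA : GeneralOrthogonalPosition A) (hB : GeneralOrthogonalPosition B)
    (hT : IsDescending T) (hTc : T.card = m + 1) (hAT : ∀ a ∈ A, ∀ t ∈ T, a.1 < t.1 ∧ a.2 < t.2)
    (hBT : ∀ b ∈ B, ∀ t ∈ T, t.1 < b.1 ∧ b.2 < t.2)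
    (hAB : ∀ k, m = k + 1 → 2 * f k ≤ A.card + B.card) (ρ C : ℝ) (hAρ : ∀ a ∈ A, a.2 < ρ)
    (hBC : ∀ b ∈ B, b.1 < C) (hTρ : ∀ t ∈ T, ρ ≤ t.2) (hTC : ∀ t ∈ T, t.1 < C) :
    ∃ p ∈ T, ∃ I, TreeDrawing ((A : Set (ℝ × ℝ)) ∪ B ∪ T) m p I ∧
      ∀ z ∈ I, z.2 ≤ p.2 ∧ z.1 < C ∧ (z.1 < p.1 → z.2 < ρ) := by
  classical
  induction m generalizing T A B ρ C with
  | zero =>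
    obtain ⟨t, rfl⟩ := Finset.card_eq_one.1 hTc
    refine ⟨t, by simp, {t}, .leaf t (by simp), ?_⟩
    rintro z rfl
    exact ⟨le_rfl, hTC z (by simp), fun h => (lt_irrefl _ h).elim⟩
  | succ m ih =>
    -- The leftmost point of a descending set is also the highest; it becomes the root.
    obtain ⟨p, hp, hmin⟩ := T.exists_min_image Prod.fst (Finset.card_pos.1 (by omega))
    have hpT : ∀ t ∈ T.erase p, p.1 < t.1 ∧ t.2 < p.2 := by
      intro t ht
      obtain ⟨h1, h2⟩ := Finset.mem_erase.1 ht
      rcases hT p hp t h2 h1.symm with h | h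
      · exact h
      · exact ((hmin t h2).not_gt h.1).elim
    have hsub : T.erase p ⊆ T := Finset.erase_subset _ _
    have hTc' : (T.erase p).card = m + 1 := by rw [Finset.card_erase_of_mem hp, hTc]; rfl
    have hT' : IsDescending (T.erase p) := fun x hx y hy => hT x (hsub hx) y (hsub hy)
    have hup' : ∀ k < m, UpUniversal k (f k) := fun k hk => hup k (by omega)
    have h2 := hAB m rfl
    obtain ⟨n, hn⟩ : ∃ n, f m = n + 1 := ⟨f m - 1, by have := hf m; omega⟩
    -- Pigeonhole: one of `A` and `B` has at least `f m` points, enough for the hanging subtree.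
    by_cases hcase : f m ≤ A.card
    · obtain ⟨A₁, hA₁, hc, a₀, ha₀, hle, hlt⟩ :=
        exists_top_subset A Prod.snd hA.2 n (by omega)
      obtain ⟨q, J, hJ, hray⟩ := (hup m (by omega)).rightDrawable A₁ (hA.subset hA₁) (by omega)
      have hrest : A \ A₁ ⊆ A := Finset.sdiff_subset
      -- The highest points of `A` form the row. With `ρ` lowered to its bottom `a₀.2`, whatever of
      -- the remaining drawing lies left of its root stays below the row. At least `f m` points are
      -- left, twice the next demand.
      obtain ⟨r, hr, I, hI, hI1⟩ := ih hup' (T.erase p) (A \ A₁) B (hA.subset hrest) hB hT' hTc'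
        (fun a ha t ht => hAT a (hrest ha) t (hsub ht)) (fun b hb t ht => hBT b hb t (hsub ht))
        (fun k hk => by
          subst hk
          have := hf2 k
          rw [Finset.card_sdiff_of_subset hA₁]
          omega)
        a₀.2 C hlt hBC (fun t ht => (hAT a₀ (hA₁ ha₀) t (hsub ht)).2.le)
        (fun t ht => hTC t (hsub ht))
      have hbox : ∀ z ∈ J, z.1 < p.1 ∧ a₀.2 ≤ z.2 ∧ z.2 < p.2 ∧ z.2 < ρ := by
        intro z hz
        obtain ⟨-, ⟨x, hx, hx'⟩, ⟨y, hy, hy'⟩, ⟨w, hw, hw'⟩⟩ := hJ.ink_subset_boundingBox hz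
        exact ⟨hx'.trans_lt (hAT x (hA₁ hx) p hp).1, (hle y hy).trans hy',
          hw'.trans_lt (hAT w (hA₁ hw) p hp).2, hw'.trans_lt (hAρ w (hA₁ hw))⟩
      obtain ⟨hpr, hrp⟩ := hpT r hr
      refine ⟨p, hp, _, TreeDrawing.join_row (θ := a₀.2) (Or.inr hp) (hJ.mono ?_) (hI.mono ?_)
        (fun z hz => ⟨(hbox z hz).1, (hbox z hz).2.1, (hbox z hz).2.2.1⟩) hray
        (fun z hz => ⟨(hI1 z hz).1, (hI1 z hz).2.2⟩) hpr hrp, ?_⟩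
      · exact fun z hz => Or.inl (Or.inl (hA₁ hz))
      · rintro z ((hz | hz) | hz)
        · exact Or.inl (Or.inl (hrest hz))
        · exact Or.inl (Or.inr hz)
        · exact Or.inr (hsub hz)
      · have hq := hbox q hJ.root_mem_ink
        have hpC := hTC p hp
        have hrC := hTC r (hsub hr)
        have haρ := hAρ a₀ (hA₁ ha₀)
        rintro z ((hz | hz) | (hz | hz))
        · have := hbox z hz
          exact ⟨by linarith, by linarith, fun _ => by linarith⟩
        · have := mem_leg_of_vertical hz
          rw [Set.uIcc_of_ge hq.2.2.1.le, Set.uIcc_of_ge hq.1.le] at this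
          rcases this with ⟨h1, h2, h3⟩ | ⟨h1, h2, h3⟩
          · exact ⟨by linarith, by linarith, fun _ => by linarith⟩
          · exact ⟨by linarith, by linarith, fun _ => by linarith⟩
        · have h1 := hI1 z hz
          exact ⟨by linarith, by linarith, fun h => (h1.2.2 (by linarith)).trans haρ⟩
        · have := mem_leg_of_horizontal hz
          rw [Set.uIcc_of_le hpr.le, Set.uIcc_of_ge hrp.le] at this
          rcases this with ⟨h1, h2, h3⟩ | ⟨h1, h2, h3⟩
          · exact ⟨by linarith, by linarith, fun _ => by linarith⟩
          · exact ⟨by linarith, by linarith, fun _ => by linarith⟩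
    · obtain ⟨B₁, hB₁, hc, b₀, hb₀, hle, hlt⟩ :=
        exists_top_subset B Prod.fst hB.1 n (by omega)
      obtain ⟨q, J, hJ, hray⟩ := hup m (by omega) B₁ (hB.subset hB₁) (by omega)
      have hrest : B \ B₁ ⊆ B := Finset.sdiff_subset
      -- The rightmost points of `B` form the column. With `C` moved to its left end `b₀.1`, the
      -- remaining drawing stays left of the column; `ρ` keeps the horizontal approach to `r` free.
      obtain ⟨r, hr, I, hI, hI1⟩ := ih hup' (T.erase p) A (B \ B₁) hA (hB.subset hrest) hT' hTc'
        (fun a ha t ht => hAT a ha t (hsub ht)) (fun b hb t ht => hBT b (hrest hb) t (hsub ht))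
        (fun k hk => by
          subst hk
          have := hf2 k
          rw [Finset.card_sdiff_of_subset hB₁]
          omega)
        ρ b₀.1 hAρ hlt (fun t ht => hTρ t (hsub ht))
        (fun t ht => (hBT b₀ (hB₁ hb₀) t (hsub ht)).1)
      have hbox : ∀ z ∈ J, b₀.1 ≤ z.1 ∧ z.2 < p.2 ∧ z.1 < C := by
        intro z hz
        obtain ⟨⟨x, hx, hx'⟩, ⟨y, hy, hy'⟩, -, ⟨w, hw, hw'⟩⟩ := hJ.ink_subset_boundingBox hz
        exact ⟨(hle x hx).trans hx', hw'.trans_lt (hBT w (hB₁ hw) p hp).2,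
          hy'.trans_lt (hBC y (hB₁ hy))⟩
      obtain ⟨hpr, hrp⟩ := hpT r hr
      refine ⟨p, hp, _, TreeDrawing.join_column (θ := b₀.1) (ρ := ρ) (Or.inr hp) (hJ.mono ?_)
        (hI.mono ?_) (fun z hz => ⟨(hbox z hz).1, (hbox z hz).2.1⟩) hray hI1 (hTρ r (hsub hr))
        hpr hrp, ?_⟩
      · exact fun z hz => Or.inl (Or.inr (hB₁ hz))
      · rintro z ((hz | hz) | hz)
        · exact Or.inl (Or.inl hz)
        · exact Or.inl (Or.inr (hrest hz))
        · exact Or.inr (hsub hz)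
      · have hq := hbox q hJ.root_mem_ink
        have hpC := hTC p hp
        have hpb := (hBT b₀ (hB₁ hb₀) p hp).1
        have hbC := hBC b₀ (hB₁ hb₀)
        have hrb := (hBT b₀ (hB₁ hb₀) r (hsub hr)).1
        have hpq : p.1 < q.1 := by linarith
        rintro z ((hz | hz) | (hz | hz))
        · have := hbox z hz
          exact ⟨by linarith, by linarith, fun _ => by linarith⟩
        · have := mem_leg_of_horizontal hz
          rw [Set.uIcc_of_le hpq.le, Set.uIcc_of_ge hq.2.1.le] at this
          rcases this with ⟨h1, h2, h3⟩ | ⟨h1, h2, h3⟩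
          · exact ⟨by linarith, by linarith, fun _ => by linarith⟩
          · exact ⟨by linarith, by linarith, fun _ => by linarith⟩
        · have h1 := hI1 z hz
          exact ⟨by linarith, by linarith, fun h => h1.2.2 (by linarith)⟩
        · have := mem_leg_of_vertical hz
          rw [Set.uIcc_of_le hpr.le, Set.uIcc_of_ge hrp.le] at this
          rcases this with ⟨h1, h2, h3⟩ | ⟨h1, h2, h3⟩
          · exact ⟨by linarith, by linarith, fun _ => by linarith⟩
          · exact ⟨by linarith, by linarith, fun _ => by linarith⟩

end Staircases

/-! ### The recursion for the number of points and its solution. -/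

section UpperBound

theorem upDrawable_of_isDescending {f : ℕ → ℕ} (hf : ∀ m, 1 ≤ f m)
    (hf2 : ∀ m, 2 * f m ≤ f (m + 1)) {m : ℕ} (hup : ∀ k ≤ m, UpUniversal k (f k))
    {S T D : Finset (ℝ × ℝ)} (hS : GeneralOrthogonalPosition S) (hTS : T ⊆ S) (hDS : D ⊆ S)
    (hT : IsDescending T) (hTc : T.card = m + 2) (hDT : ∀ d ∈ D, ∀ t ∈ T, d.2 < t.2)
    {A B : Finset (ℝ × ℝ)} (hA : A ⊆ D) (hB : B ⊆ D) (hAT : ∀ a ∈ A, ∀ t ∈ T, a.1 < t.1)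
    (hBT : ∀ b ∈ B, ∀ t ∈ T, t.1 < b.1) (hAB : 2 * f m ≤ A.card + B.card) :
    UpDrawable (m + 1) (S : Set (ℝ × ℝ)) := by
  have hTne : T.Nonempty := Finset.card_pos.1 (by omega)
  obtain ⟨t₀, ht₀, hmin⟩ := T.exists_min_image Prod.snd hTne
  obtain ⟨s₀, hs₀, hmax⟩ := S.exists_max_image Prod.fst (hTne.mono hTS)
  have hC : ∀ s ∈ S, s.1 < s₀.1 + 1 := fun s hs => (hmax s hs).trans_lt (lt_add_one _)
  obtain ⟨p, hp, I, hI, hI1⟩ := exists_treeDrawing_of_isDescending hf hf2 (m + 1)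
    (fun k hk => hup k (by omega)) T A B (hS.subset (hA.trans hDS)) (hS.subset (hB.trans hDS))
    hT hTc (fun a ha t ht => ⟨hAT a ha t ht, hDT a (hA ha) t ht⟩)
    (fun b hb t ht => ⟨hBT b hb t ht, hDT b (hB hb) t ht⟩)
    (fun k hk => by obtain rfl : m = k := by omega
                    exact hAB)
    t₀.2 (s₀.1 + 1) (fun a ha => hDT a (hA ha) t₀ ht₀) (fun b hb => hC b (hDS (hB hb))) hmin
    (fun t ht => hC t (hTS ht))
  refine ⟨p, I, hI.mono ?_, fun z hz _ => (hI1 z hz).1⟩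
  rintro z ((hz | hz) | hz)
  · exact hDS (hA hz)
  · exact hDS (hB hz)
  · exact hTS hz

theorem generalOrthogonalPosition_reflect {S : Finset (ℝ × ℝ)}
    (hS : GeneralOrthogonalPosition S) : GeneralOrthogonalPosition (S.image reflect) := by
  constructor
  · intro x hx y hy hxy
    simp only [Finset.coe_image, Set.mem_image, Finset.mem_coe] at hx hy
    obtain ⟨x, hx, rfl⟩ := hx
    obtain ⟨y, hy, rfl⟩ := hy
    rw [hS.1 hx hy (by simpa using hxy)]
  · intro x hx y hy hxy
    simp only [Finset.coe_image, Set.mem_image, Finset.mem_coe] at hx hy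
    obtain ⟨x, hx, rfl⟩ := hx
    obtain ⟨y, hy, rfl⟩ := hy
    rw [hS.2 hx hy (by simpa using hxy)]

/-- Reflecting in the vertical axis makes an ascending spine descend and exchanges the roles of `A`
and `B`; free upward rays survive. -/
theorem upDrawable_of_isDescending_reflect {f : ℕ → ℕ} (hf : ∀ m, 1 ≤ f m)
    (hf2 : ∀ m, 2 * f m ≤ f (m + 1)) {m : ℕ} (hup : ∀ k ≤ m, UpUniversal k (f k))
    {S T D : Finset (ℝ × ℝ)} (hS : GeneralOrthogonalPosition S) (hTS : T ⊆ S) (hDS : D ⊆ S)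
    (hT : IsDescending (T.image reflect)) (hTc : T.card = m + 2)
    (hDT : ∀ d ∈ D, ∀ t ∈ T, d.2 < t.2)
    {A B : Finset (ℝ × ℝ)} (hA : A ⊆ D) (hB : B ⊆ D) (hAT : ∀ a ∈ A, ∀ t ∈ T, a.1 < t.1)
    (hBT : ∀ b ∈ B, ∀ t ∈ T, t.1 < b.1) (hAB : 2 * f m ≤ A.card + B.card) :
    UpDrawable (m + 1) (S : Set (ℝ × ℝ)) := by
  have hcard : ∀ X : Finset (ℝ × ℝ), (X.image reflect).card = X.card := fun X =>
    Finset.card_image_of_injective _ reflect_injective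
  have h := upDrawable_of_isDescending hf hf2 hup (generalOrthogonalPosition_reflect hS)
    (Finset.image_subset_image hTS) (Finset.image_subset_image hDS) hT (by rw [hcard, hTc])
    (by
      simp only [Finset.forall_mem_image]
      exact hDT)
    (Finset.image_subset_image hB) (Finset.image_subset_image hA)
    (by
      simp only [Finset.forall_mem_image, reflect_apply, neg_lt_neg_iff]
      exact hBT)
    (by
      simp only [Finset.forall_mem_image, reflect_apply, neg_lt_neg_iff]
      exact hAT)
    (by rw [hcard, hcard]; omega)
  have h' := h.reflect
  rw [Finset.coe_image, Set.image_image] at h'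
  simpa using h'

theorem upUniversal {f : ℕ → ℕ} (hf : ∀ m, 1 ≤ f m) (hf2 : ∀ m, 2 * f m ≤ f (m + 1))
    (hrec : ∀ m, 80 * f m + 1560 * ((m + 1) * (m + 1) + 1) ≤ 39 * f (m + 1)) (m : ℕ) :
    UpUniversal m (f m) := by
  classical
  induction m using Nat.strong_induction_on with
  | _ m ih =>
  intro S hS hSc
  rcases m with _ | m
  · obtain ⟨p, hp⟩ := Finset.card_pos.1 ((hf 0).trans hSc)
    refine ⟨p, {p}, .leaf p hp, ?_⟩
    rintro z rfl _
    exact le_rfl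
  have hr := hrec m
  set w := (m + 1) * (m + 1) with hw
  -- `U` has `40 * (w + 1)` points, that is 40 blocks of `w + 1`; one point more than `(m + 1) * (m
  -- + 1)` forces a monotone subset of size `m + 2`.
  obtain ⟨U, hU, hUc, u₀, -, hle, hlt⟩ :=
    exists_top_subset S Prod.snd hS.2 (40 * w + 39) (by omega)
  obtain ⟨W, hW, hWc, hbet⟩ := exists_few_between 39 w U (S \ U)
    (hS.subset hU).1 (by omega)
  have hDc : (S \ U).card = S.card - U.card := Finset.card_sdiff_of_subset hU
  set D := S \ U with hD
  have hDU : ∀ d ∈ D, ∀ t ∈ U, d.2 < t.2 := fun d hd t ht => (hlt d hd).trans_le (hle t ht)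
  set A := D.filter (fun d => ∀ t ∈ W, d.1 < t.1) with hA
  set B := D.filter (fun d => ∀ t ∈ W, t.1 < d.1) with hB
  have hcover : D ⊆ (A ∪ B) ∪ between D W := by
    intro d hd
    simp only [Finset.mem_union, hA, hB, between, Finset.mem_filter, hd, true_and]
    by_contra! hcon
    obtain ⟨⟨⟨x, hx, hx'⟩, ⟨y, hy, hy'⟩⟩, h3⟩ := hcon
    exact ((h3 ⟨x, hx, hx'⟩) y hy).not_ge hy'
  have hcount := (Finset.card_le_card hcover).trans (Finset.card_union_le _ _)
  have hcount' := Finset.card_union_le A B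
  -- At least 39/40 of `D` survives in `A ∪ B`; the 1560 in `hrec` is `39 * 40`, the cost of
  -- removing `U`.
  have hAB : 2 * f m ≤ A.card + B.card := by omega
  have hup : ∀ k ≤ m, UpUniversal k (f k) := fun k hk => ih k (by omega)
  have hSW : GeneralOrthogonalPosition W := hS.subset (hW.trans hU)
  rcases exists_chain_or_antichain (m + 1) (m + 1) W (by omega) with
    ⟨T, hT, hTc, hch⟩ | ⟨T, hT, hTc, hch⟩
  · refine upDrawable_of_isDescending_reflect (A := A) (B := B) hf hf2 hup hS
      (hT.trans (hW.trans hU)) Finset.sdiff_subset ?_ hTc (fun d hd t ht => hDU d hd t (hW (hT ht)))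
      (Finset.filter_subset _ _) (Finset.filter_subset _ _)
      (fun a ha t ht => (Finset.mem_filter.1 ha).2 t (hT ht))
      (fun a ha t ht => (Finset.mem_filter.1 ha).2 t (hT ht)) hAB
    simp only [IsDescending, Finset.forall_mem_image, reflect_apply, neg_lt_neg_iff]
    intro p hp q hq hpq
    rcases hch p hp q hq (fun h => hpq (by rw [h])) with h | h
    · exact Or.inr h
    · exact Or.inl h
  · refine upDrawable_of_isDescending (A := A) (B := B) hf hf2 hup hS
      (hT.trans (hW.trans hU)) Finset.sdiff_subset ?_ hTc (fun d hd t ht => hDU d hd t (hW (hT ht)))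
      (Finset.filter_subset _ _) (Finset.filter_subset _ _)
      (fun a ha t ht => (Finset.mem_filter.1 ha).2 t (hT ht))
      (fun a ha t ht => (Finset.mem_filter.1 ha).2 t (hT ht)) hAB
    intro p hp q hq hpq
    have h1 : p.1 ≠ q.1 := fun h => hpq (hSW.1 (hT hp) (hT hq) h)
    have h2 : p.2 ≠ q.2 := fun h => hpq (hSW.2 (hT hp) (hT hq) h)
    rcases h1.lt_or_gt with h | h
    · exact Or.inl ⟨h, lt_of_le_of_ne (not_lt.1 fun h' => hch p hp q hq ⟨h, h'⟩) h2.symm⟩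
    · exact Or.inr ⟨h, lt_of_le_of_ne (not_lt.1 fun h' => hch q hq p hp ⟨h, h'⟩) h2⟩

/-- A number of points that suffices for the perfect binary tree of height `m`. -/
noncomputable def pointBound (m : ℕ) : ℕ := ⌈(4000 : ℝ) * 2.1 ^ m⌉₊

theorem succ_mul_succ_add_one_le (m : ℕ) : (m + 1) * (m + 1) + 1 ≤ 4 * 2 ^ m := by
  rcases m with _ | m
  · norm_num
  induction m with
  | zero => norm_num
  | succ m ih =>
    rw [pow_succ]
    nlinarith

/-- Since `39 * 2.1 = 81.9`, the main terms leave a slack of `1.9 * 4000 = 7600` times `2.1 ^ m`.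
Rounding costs at most 80 and the quadratic term at most `1560 * 4 = 6240` times `2 ^ m`. -/
theorem pointBound_rec (m : ℕ) :
    80 * pointBound m + 1560 * ((m + 1) * (m + 1) + 1) ≤ 39 * pointBound (m + 1) := by
  have h1 : (pointBound m : ℝ) < 4000 * 2.1 ^ m + 1 := Nat.ceil_lt_add_one (by positivity)
  have h2 : (4000 : ℝ) * 2.1 ^ (m + 1) ≤ pointBound (m + 1) := Nat.le_ceil _
  have h3 : (((m + 1) * (m + 1) + 1 : ℕ) : ℝ) ≤ ((4 * 2 ^ m : ℕ) : ℝ) := by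
    exact_mod_cast succ_mul_succ_add_one_le m
  have h4 : (2 : ℝ) ^ m ≤ 2.1 ^ m := pow_le_pow_left₀ (by norm_num) (by norm_num) m
  have h5 : (1 : ℝ) ≤ 2.1 ^ m := one_le_pow₀ (by norm_num)
  have h6 : ((80 * pointBound m + 1560 * ((m + 1) * (m + 1) + 1) : ℕ) : ℝ) ≤
      ((39 * pointBound (m + 1) : ℕ) : ℝ) := by
    push_cast at h3 ⊢
    rw [pow_succ] at h2
    linarith
  exact_mod_cast h6

theorem one_le_pointBound (m : ℕ) : 1 ≤ pointBound m := Nat.ceil_pos.2 (by positivity)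

theorem two_mul_pointBound_le (m : ℕ) : 2 * pointBound m ≤ pointBound (m + 1) := by
  have := pointBound_rec m
  omega

theorem pointBound_le (m : ℕ) (n : ℕ) (hn : 2 ^ m ≤ n) :
    (pointBound m : ℝ) ≤ 4001 * (n : ℝ) ^ (1.142 : ℝ) := by
  have h1 : (pointBound m : ℝ) < 4000 * 2.1 ^ m + 1 := Nat.ceil_lt_add_one (by positivity)
  have h5 : (1 : ℝ) ≤ 2.1 ^ m := one_le_pow₀ (by norm_num)
  have hx : (2.1 : ℝ) ≤ 2 ^ (1.142 : ℝ) := by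
    -- Reduces to `2.1 ^ 10 ≤ 2 ^ 11`; the exponent 1.142 is not needed in full.
    have h : (2.1 : ℝ) ≤ 2 ^ (1.1 : ℝ) := by
      rw [← pow_le_pow_iff_left₀ (n := 10) (by norm_num) (by positivity) (by norm_num),
        ← Real.rpow_natCast (2 ^ (1.1 : ℝ)), ← Real.rpow_mul (by norm_num)]
      have : (1.1 : ℝ) * ((10 : ℕ) : ℝ) = ((11 : ℕ) : ℝ) := by norm_num
      rw [this, Real.rpow_natCast]
      norm_num
    exact h.trans (Real.rpow_le_rpow_of_exponent_le (by norm_num) (by norm_num))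
  have hpow : (2.1 : ℝ) ^ m ≤ (n : ℝ) ^ (1.142 : ℝ) := by
    calc (2.1 : ℝ) ^ m ≤ ((2 : ℝ) ^ (1.142 : ℝ)) ^ m := pow_le_pow_left₀ (by norm_num) hx m
      _ = ((2 : ℝ) ^ m) ^ (1.142 : ℝ) := by
        rw [← Real.rpow_natCast, ← Real.rpow_mul (by norm_num), mul_comm,
          Real.rpow_mul (by norm_num), Real.rpow_natCast]
      _ ≤ (n : ℝ) ^ (1.142 : ℝ) :=
        Real.rpow_le_rpow (by positivity) (by exact_mod_cast hn) (by norm_num)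
  linarith

end UpperBound

end LShaped

theorem mainTheorem3 :
    ∃ c : ℝ, 0 < c ∧
      ∀ (V : Type*) [Fintype V] (G : SimpleGraph V) (r : V),
        LShaped.IsPerfectBinaryTree G r →
        ∀ P : Finset (ℝ × ℝ), LShaped.GeneralOrthogonalPosition P →
          c * (Fintype.card V : ℝ) ^ (1.142 : ℝ) ≤ (P.card : ℝ) →
          Nonempty (LShaped.PlanarLDrawing G P) := by
  refine ⟨4001, by norm_num, fun V _ G r hG P hP hc => ?_⟩
  obtain ⟨m, hm, hdraw⟩ := hG.exists_height
  have hcard : LShaped.pointBound m ≤ P.card := by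
    exact_mod_cast (LShaped.pointBound_le m _ hm).trans hc
  obtain ⟨p, I, hD, -⟩ := LShaped.upUniversal LShaped.one_le_pointBound
    LShaped.two_mul_pointBound_le LShaped.pointBound_rec m P hP hcard
  exact hdraw P p I hD
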